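/- Let $A=\ell^\infty(\mathbb N)$ with $\mathbb N=\{0,1,2,\dots\}$, let $\chi\in A$ be the characteristic function of $\{n\ge 1\}$, and let $E=\chi A$, regarded as a right Hilbert $A$-module with inner product $\langle x|y\rangle=x^*y$. Let $\varphi:A\to B(E)$ send $a$ to multiplication by its shift $\sigma(a)$, where $\sigma(a)(0)=0$ and $\sigma(a)(n)=a(n-1)$ for $n\ge 1$. Let $B=\mathcal O_E$ be the Cuntz–Pimsner algebra of the correspondence $(A,E,\varphi)$, that is, the $C^*$-algebra generated by the universal pair $(\pi,t)$ of a unital $*$-homomorphism $\pi$ on $A$ and a linear map $t$ on $E$ such that $t(x)^*t(y)=\pi(\langle x|y\rangle)$, $\pi(a)t(x)=t(\varphi(a)x)$, and $\psi(\varphi(a))=\pi(a)$ for all $a\in J_E=\varphi^{-1}(K(E))\cap(\ker\varphi)^\perp$, where $\psi$ is the map on the compact operators $K(E)$ determined by $|x\rangle\langle y|\mapsto t(x)t(y)^*$. Let $\gamma$ be the gauge action of the circle on $B$, which fixes $\pi(A)$ and satisfies $\gamma_z(t(x))=z\,t(x)$; for $n\in\mathbb Z$ put $B_n=\{b\in B:\gamma_z(b)=z^n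 b\text{ for all }|z|=1\}$, and let products of such subspaces denote linear spans of products of elements. Then $E$ is finitely generated as a right $A$-module, $\varphi$ is injective, $B_1^*B_1=B_{-1}B_{-1}^*$, and the unit $1\in B$ does not belong to the norm closure of $B_1^*B_1$. Moreover the gauge action is not free: the linear span of the functions $z\mapsto a\,\gamma_z(b)$, $a,b\in B$, is not norm dense in $C(\mathbb S^1,B)$. -/

import Mathlib

open scoped ENNReal RightActions
open MulOpposite

noncomputable section

universe u

namespace CStarCorr

/-! ### Correspondences over a unital C⋆-algebra

Mathlib's `CStarModule B E` asks for `⟪x, b • y⟫ = b * ⟪x, y⟫`, so a right Hilbert `A`-module is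
a complete `CStarModule` over the opposite algebra `Aᵐᵒᵖ`; the right action is `x <• a = op a • x`.
-/

/-- The `A`-valued inner product `⟨x | y⟩` of a right Hilbert `A`-module, conjugate linear in `x`
and right `A`-linear in `y`. -/
def rightInner (A : Type u) {E : Type u} [Inner Aᵐᵒᵖ E] (x y : E) : A := unop (inner Aᵐᵒᵖ x y)

section Correspondence

variable (A E : Type u) [CStarAlgebra A] [PartialOrder A] [StarOrderedRing A]
  [NormedAddCommGroup E] [NormedSpace ℂ E] [CompleteSpace E] [Module Aᵐᵒᵖ E] [CStarModule Aᵐᵒᵖ E]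

/-- A unital C⋆-correspondence over `A`, with underlying right Hilbert `A`-module `E`: a unital
`*`-homomorphism `φ = leftAct` from `A` to the adjointable operators on `E`. -/
structure Correspondence where
  /-- The left action. -/
  leftAct : A →ₐ[ℂ] (E →L[ℂ] E)
  /-- `φ(a)` is adjointable with adjoint `φ(a⋆)`. -/
  rightInner_leftAct : ∀ (a : A) (x y : E),
    rightInner A (leftAct a x) y = rightInner A x (leftAct (star a) y)

variable {E}

set_option linter.unusedSectionVars false in
theorem smul_op_smul (c : ℂ) (b : Aᵐᵒᵖ) (x : E) : (c • b) • x = c • b • x := by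
  rw [← sub_eq_zero, ← CStarModule.inner_self (A := Aᵐᵒᵖ)]
  have h : ∀ w : E, inner Aᵐᵒᵖ w ((c • b) • x - c • b • x) = 0 := fun w => by
    rw [CStarModule.inner_sub_right, CStarModule.inner_op_smul_right,
      CStarModule.inner_smul_right_complex, CStarModule.inner_op_smul_right, smul_mul_assoc,
      sub_self]
  exact h _

set_option linter.unusedSectionVars false in
theorem norm_op_smul_le (b : Aᵐᵒᵖ) (x : E) : ‖b • x‖ ≤ ‖b‖ * ‖x‖ := by
  refine abs_le_of_sq_le_sq' ?_ (by positivity) |>.2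
  rw [CStarModule.norm_sq_eq Aᵐᵒᵖ, CStarModule.inner_op_smul_right,
    CStarModule.inner_op_smul_left, mul_pow, CStarModule.norm_sq_eq Aᵐᵒᵖ (x := x)]
  calc _ ≤ ‖b‖ * (‖inner Aᵐᵒᵖ x x‖ * ‖star b‖) :=
        (norm_mul_le _ _).trans (mul_le_mul_of_nonneg_left (norm_mul_le _ _) (norm_nonneg _))
    _ = _ := by rw [norm_star]; ring

/-- The rank one operator `|x⟩⟨y| : z ↦ x ⟨y | z⟩`. -/
def rankOne (x y : E) : E →L[ℂ] E :=
  LinearMap.mkContinuous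
    { toFun := fun z => x <• rightInner A y z
      map_add' := fun z w => by simp [rightInner, add_smul]
      map_smul' := fun c z => by simp [rightInner, smul_op_smul] }
    (‖x‖ * ‖y‖) (fun z => by
      have h1 := norm_op_smul_le A (op (rightInner A y z)) x
      have h2 : ‖op (rightInner A y z)‖ ≤ ‖y‖ * ‖z‖ := CStarModule.norm_inner_le (A := Aᵐᵒᵖ) E
      have h3 := mul_le_mul_of_nonneg_right h2 (norm_nonneg x)
      calc _ ≤ _ := h1
        _ ≤ _ := h3
        _ = _ := by ring)

variable (E) in
/-- The compact operators `K(E)`: the closed linear span of the rank one operators. -/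
def compactOperators : Submodule ℂ (E →L[ℂ] E) :=
  (Submodule.span ℂ (Set.range fun p : E × E => rankOne A p.1 p.2)).topologicalClosure

theorem rankOne_mem (x y : E) : rankOne A x y ∈ compactOperators A E :=
  Submodule.le_topologicalClosure _ (Submodule.subset_span ⟨(x, y), rfl⟩)

end Correspondence

/-! ### The Cuntz–Pimsner algebra -/

section CuntzPimsner

variable {A E : Type u} [CStarAlgebra A] [PartialOrder A] [StarOrderedRing A]
  [NormedAddCommGroup E] [NormedSpace ℂ E] [CompleteSpace E] [Module Aᵐᵒᵖ E] [CStarModule Aᵐᵒᵖ E]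

/-- The correspondence is faithful if `φ` is injective. -/
def Correspondence.IsFaithful (X : Correspondence A E) : Prop := Function.Injective X.leftAct

/-- The ideal `J_E = φ⁻¹(K(E)) ∩ (ker φ)^⊥` of `A`. -/
def Correspondence.katsuraIdeal (X : Correspondence A E) : Set A :=
  {a | X.leftAct a ∈ compactOperators A E ∧ ∀ b, X.leftAct b = 0 → a * b = 0 ∧ b * a = 0}

/-- A covariant representation of a correspondence in a (nonzero, unital) C⋆-algebra `D`. -/
structure CovariantRep (X : Correspondence A E) : Type (u + 1) where
  /-- The target C⋆-algebra. -/
  D : Type u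
  [cstarAlgebra : CStarAlgebra D]
  [nontrivial : Nontrivial D]
  /-- The representation of the coefficient algebra. -/
  π : A →⋆ₐ[ℂ] D
  /-- The representation of the module. -/
  t : E →ₗ[ℂ] D
  star_t_mul_t : ∀ x y, star (t x) * t y = π (rightInner A x y)
  π_mul_t : ∀ a x, π a * t x = t (X.leftAct a x)
  /-- With `ψ : K(E) → D` the map induced by `|x⟩⟨y| ↦ t(x) t(y)⋆`, one has `ψ(φ(a)) = π(a)` for
  all `a ∈ J_E`. -/
  covariant : ∃ ψ : compactOperators A E →L[ℂ] D,
    (∀ x y, ψ ⟨rankOne A x y, rankOne_mem A x y⟩ = t x * star (t y)) ∧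
    ∀ a, ∀ ha : a ∈ X.katsuraIdeal, ψ ⟨X.leftAct a, ha.1⟩ = π a

attribute [instance] CovariantRep.cstarAlgebra CovariantRep.nontrivial

instance (priority := 10) lpInftyCStarAlgebra {I : Type*} (B : I → Type*) [∀ i, Nontrivial (B i)]
    [∀ i, CStarAlgebra (B i)] : CStarAlgebra (lp B ∞) where

theorem continuous_starAlgHom {B C : Type*} [CStarAlgebra B] [CStarAlgebra C]
    (f : B →⋆ₐ[ℂ] C) : Continuous f :=
  AddMonoidHomClass.continuous_of_bound f 1 fun b => by
    rw [one_mul]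
    exact NonUnitalStarAlgHom.norm_apply_le f b

/-- The C⋆-algebra of bounded families indexed by all covariant representations. The
representations in C⋆-algebras in the universe of `A` and `E` suffice, because the C⋆-algebra
generated by the image of any representation has a copy there. -/
def BoundedFamily (X : Correspondence A E) : Type (u + 1) :=
  lp (fun ρ : CovariantRep X => ρ.D) ∞

instance (X : Correspondence A E) : CStarAlgebra (BoundedFamily X) :=
  inferInstanceAs (CStarAlgebra (lp (fun ρ : CovariantRep X => ρ.D) ∞))

/-- The member of a bounded family at a covariant representation. -/
def BoundedFamily.at {X : Correspondence A E} (f : BoundedFamily X) (ρ : CovariantRep X) : ρ.D :=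
  Subtype.val f ρ

theorem BoundedFamily.norm_at_le {X : Correspondence A E} (f : BoundedFamily X)
    (ρ : CovariantRep X) : ‖f.at ρ‖ ≤ ‖f‖ :=
  lp.norm_apply_le_norm (E := fun ρ : CovariantRep X => ρ.D) ENNReal.top_ne_zero f ρ

/-- The family `(π(a))` over all covariant representations `(π, t)`. -/
def coeffFamily (X : Correspondence A E) (a : A) : BoundedFamily X :=
  ⟨fun ρ => ρ.π a, memℓp_infty ⟨‖a‖, by
    rintro _ ⟨ρ, rfl⟩
    exact NonUnitalStarAlgHom.norm_apply_le ρ.π a⟩⟩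

theorem CovariantRep.norm_t_le {X : Correspondence A E} (ρ : CovariantRep X) (x : E) :
    ‖ρ.t x‖ ≤ ‖x‖ := by
  refine abs_le_of_sq_le_sq' ?_ (by positivity) |>.2
  rw [CStarModule.norm_sq_eq Aᵐᵒᵖ (x := x), sq, ← CStarRing.norm_star_mul_self, ρ.star_t_mul_t]
  exact NonUnitalStarAlgHom.norm_apply_le ρ.π _

/-- The family `(t(x))` over all covariant representations `(π, t)`. -/
def moduleFamily (X : Correspondence A E) (x : E) : BoundedFamily X :=
  ⟨fun ρ => ρ.t x, memℓp_infty ⟨‖x‖, by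
    rintro _ ⟨ρ, rfl⟩
    exact ρ.norm_t_le x⟩⟩

/-- The `*`-algebra generated by the universal covariant representation. -/
def generatedAlgebra (X : Correspondence A E) : StarSubalgebra ℂ (BoundedFamily X) :=
  StarAlgebra.adjoin ℂ (Set.range (coeffFamily X) ∪ Set.range (moduleFamily X))

/-- The Cuntz–Pimsner algebra `O_E`: the C⋆-algebra generated by the universal covariant
representation of the correspondence. -/
def CuntzPimsner (X : Correspondence A E) : Type (u + 1) :=
  (generatedAlgebra X).topologicalClosure

instance (X : Correspondence A E) : CStarAlgebra (CuntzPimsner X) :=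
  haveI : IsClosed ((generatedAlgebra X).topologicalClosure : Set (BoundedFamily X)) :=
    StarSubalgebra.isClosed_topologicalClosure _
  inferInstanceAs (CStarAlgebra (generatedAlgebra X).topologicalClosure)

/-- The canonical element of `O_E` given by `a ∈ A`. -/
def coeff (X : Correspondence A E) (a : A) : CuntzPimsner X :=
  ⟨coeffFamily X a, StarSubalgebra.le_topologicalClosure _
    (StarAlgebra.subset_adjoin ℂ _ (Or.inl ⟨a, rfl⟩))⟩

/-- The canonical element of `O_E` given by `x ∈ E`. -/
def creation (X : Correspondence A E) (x : E) : CuntzPimsner X :=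
  ⟨moduleFamily X x, StarSubalgebra.le_topologicalClosure _
    (StarAlgebra.subset_adjoin ℂ _ (Or.inr ⟨x, rfl⟩))⟩

/-- The inclusion of `O_E` in the algebra of bounded families. -/
def CuntzPimsner.incl (X : Correspondence A E) : CuntzPimsner X →⋆ₐ[ℂ] BoundedFamily X :=
  StarSubalgebra.subtype (generatedAlgebra X).topologicalClosure

/-- The universal property: a covariant representation `(π, t)` in `D` gives a
`*`-homomorphism `O_E → D`. -/
def CuntzPimsner.lift {X : Correspondence A E} (ρ : CovariantRep X) :
    CuntzPimsner X →⋆ₐ[ℂ] ρ.D where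
  toFun f := (CuntzPimsner.incl X f).at ρ
  map_one' := rfl
  map_mul' _ _ := rfl
  map_zero' := rfl
  map_add' _ _ := rfl
  commutes' _ := rfl
  map_star' _ := rfl

theorem CuntzPimsner.lift_coeff {X : Correspondence A E} (ρ : CovariantRep X) (a : A) :
    CuntzPimsner.lift ρ (coeff X a) = ρ.π a := rfl

theorem CuntzPimsner.lift_creation {X : Correspondence A E} (ρ : CovariantRep X) (x : E) :
    CuntzPimsner.lift ρ (creation X x) = ρ.t x := rfl

/-- `O_E` is generated as a C⋆-algebra by the images of `A` and `E`. -/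
theorem CuntzPimsner.hom_ext {X : Correspondence A E} {B : Type*} [CStarAlgebra B]
    {f g : CuntzPimsner X →⋆ₐ[ℂ] B}
    (h1 : ∀ a, f (coeff X a) = g (coeff X a)) (h2 : ∀ x, f (creation X x) = g (creation X x)) :
    f = g := by
  refine StarAlgHom.ext_topologicalClosure (S := generatedAlgebra X)
    (continuous_starAlgHom f) (continuous_starAlgHom g) ?_
  refine StarAlgHom.ext_adjoin fun x hx => ?_
  obtain ⟨x, hx'⟩ := x
  rcases hx with ⟨a, rfl⟩ | ⟨y, rfl⟩
  · exact h1 a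
  · exact h2 y

/-! ### The gauge action -/

theorem circle_star_mul_self (z : Circle) : star (z : ℂ) * (z : ℂ) = 1 := by
  simp [← Circle.coe_inv_eq_conj]

/-- The covariant representation `(π, z t)`, for `z` in the unit circle. -/
def CovariantRep.rotate {X : Correspondence A E} (z : Circle) (ρ : CovariantRep X) :
    CovariantRep X where
  D := ρ.D
  π := ρ.π
  t := (z : ℂ) • ρ.t
  star_t_mul_t x y := by
    rw [LinearMap.smul_apply, LinearMap.smul_apply, star_smul, smul_mul_smul_comm,
      ρ.star_t_mul_t, circle_star_mul_self, one_smul]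
  π_mul_t a x := by simp [ρ.π_mul_t]
  covariant := by
    obtain ⟨ψ, h1, h2⟩ := ρ.covariant
    refine ⟨ψ, fun x y => ?_, h2⟩
    rw [LinearMap.smul_apply, LinearMap.smul_apply, star_smul, smul_mul_smul_comm,
      mul_comm (z : ℂ), circle_star_mul_self, one_smul, h1]

/-- The endomorphism of the algebra of bounded families induced by `(π, t) ↦ (π, z t)`. -/
def rotateFamily (X : Correspondence A E) (z : Circle) : BoundedFamily X →⋆ₐ[ℂ] BoundedFamily X where
  toFun f := ⟨fun ρ => f.at (ρ.rotate z), memℓp_infty ⟨‖f‖, by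
    rintro _ ⟨ρ, rfl⟩
    exact f.norm_at_le (ρ.rotate z)⟩⟩
  map_one' := rfl
  map_mul' _ _ := rfl
  map_zero' := rfl
  map_add' _ _ := rfl
  commutes' _ := rfl
  map_star' _ := rfl

theorem rotateFamily_coeffFamily (X : Correspondence A E) (z : Circle) (a : A) :
    rotateFamily X z (coeffFamily X a) = coeffFamily X a := rfl

theorem rotateFamily_moduleFamily (X : Correspondence A E) (z : Circle) (x : E) :
    rotateFamily X z (moduleFamily X x) = (z : ℂ) • moduleFamily X x := rfl

theorem rotateFamily_mem (X : Correspondence A E) (z : Circle) {f : BoundedFamily X}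
    (hf : f ∈ (generatedAlgebra X).topologicalClosure) :
    rotateFamily X z f ∈ (generatedAlgebra X).topologicalClosure := by
  have hclosed : IsClosed
      (((generatedAlgebra X).topologicalClosure.comap (rotateFamily X z) :
        StarSubalgebra ℂ (BoundedFamily X)) : Set (BoundedFamily X)) :=
    (StarSubalgebra.isClosed_topologicalClosure _).preimage (continuous_starAlgHom (rotateFamily X z))
  refine StarSubalgebra.topologicalClosure_minimal (StarAlgebra.adjoin_le ?_) hclosed hf
  rintro _ (⟨a, rfl⟩ | ⟨x, rfl⟩)
  · exact (coeff X a).2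
  · exact SMulMemClass.smul_mem (z : ℂ) (creation X x).2

/-- The automorphism `γ_z` of `O_E`, fixing `A` and scaling `E` by `z`. -/
def gauge (X : Correspondence A E) (z : Circle) : CuntzPimsner X →⋆ₐ[ℂ] CuntzPimsner X :=
  ((rotateFamily X z).comp (CuntzPimsner.incl X)).codRestrict
    (generatedAlgebra X).topologicalClosure fun f => rotateFamily_mem X z f.2

theorem gauge_coeff (X : Correspondence A E) (z : Circle) (a : A) :
    gauge X z (coeff X a) = coeff X a := rfl

theorem gauge_creation (X : Correspondence A E) (z : Circle) (x : E) :
    gauge X z (creation X x) = (z : ℂ) • creation X x := rfl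

/-- The (full) gauge action of the circle on `O_E`. -/
def gaugeAction (X : Correspondence A E) : Circle →* (CuntzPimsner X →⋆ₐ[ℂ] CuntzPimsner X) where
  toFun := gauge X
  map_one' := CuntzPimsner.hom_ext (fun _ => rfl) fun x => by
    rw [gauge_creation, Circle.coe_one, one_smul]
    rfl
  map_mul' z w := CuntzPimsner.hom_ext (fun _ => rfl) fun x => by
    change _ = gauge X z (gauge X w (creation X x))
    rw [gauge_creation, gauge_creation, map_smul, gauge_creation, smul_smul, Circle.coe_mul,
      mul_comm]

end CuntzPimsner

/-! ### Free circle actions -/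

section Action

variable {B : Type*} [CStarAlgebra B]

/-- The spectral subspace `B_n` of a circle action. -/
def spectralSubspace (γ : Circle →* (B →⋆ₐ[ℂ] B)) (n : ℤ) : Submodule ℂ B where
  carrier := {b | ∀ z : Circle, γ z b = (z : ℂ) ^ n • b}
  zero_mem' z := by simp
  add_mem' ha hb z := by simp [ha z, hb z]
  smul_mem' c b hb z := by simp [hb z, smul_comm c]

/-- `V⋆ W`, the linear span of the products `v⋆ w`. -/
def starMul (V W : Submodule ℂ B) : Submodule ℂ B :=
  Submodule.span ℂ {b | ∃ v ∈ V, ∃ w ∈ W, b = star v * w}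

/-- `V W⋆`, the linear span of the products `v w⋆`. -/
def mulStar (V W : Submodule ℂ B) : Submodule ℂ B :=
  Submodule.span ℂ {b | ∃ v ∈ V, ∃ w ∈ W, b = v * star w}

/-- A circle action on `B`, with coaction `ρ : B → B ⊗ C(𝕋) = C(𝕋, B)`, `ρ(b)(z) = γ_z(b)`, is
free if the span of the elements `(a ⊗ 1) ρ(b)` is norm dense in `C(𝕋, B)`. -/
def IsFreeAction (γ : Circle →* (B →⋆ₐ[ℂ] B)) : Prop :=
  Dense (Submodule.span ℂ {F : C(Circle, B) | ∃ a b : B, ∀ z, F z = a * γ z b} : Set C(Circle, B))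

end Action

/-! ### The shift correspondence over `ℓ^∞(ℕ)` -/

section Shift

/-- The C⋆-algebra `ℓ^∞(ℕ)`. -/
abbrev EllInfty : Type := lp (fun _ : ℕ => ℂ) ∞

instance : PartialOrder EllInfty := CStarAlgebra.spectralOrder EllInfty

instance : StarOrderedRing EllInfty := CStarAlgebra.spectralOrderedRing EllInfty

/-- The characteristic function of the positive integers. -/
def chi : EllInfty :=
  ⟨fun n => if n = 0 then 0 else 1, memℓp_infty ⟨1, by
    rintro _ ⟨n, rfl⟩
    dsimp only
    split_ifs <;> simp⟩⟩

theorem chi_apply (n : ℕ) : chi n = if n = 0 then 0 else 1 := rfl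

/-- The closed right ideal `χ ℓ^∞(ℕ)`, generated by `χ`. -/
def chiIdeal : Submodule EllInftyᵐᵒᵖ EllInfty := Submodule.span EllInftyᵐᵒᵖ {chi}

theorem mem_chiIdeal {f : EllInfty} : f ∈ chiIdeal ↔ f 0 = 0 := by
  rw [chiIdeal, Submodule.mem_span_singleton]
  constructor
  · rintro ⟨a, rfl⟩
    change chi 0 * unop a 0 = 0
    simp [chi_apply]
  · intro h
    refine ⟨op f, lp.ext (funext fun n => ?_)⟩
    change chi n * f n = f n
    rcases n with _ | n
    · simp [h]
    · simp [chi_apply]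

/-- The right `ℓ^∞(ℕ)`-module `E = χ ℓ^∞(ℕ)`. -/
def ShiftModule : Type := chiIdeal

instance : NormedAddCommGroup ShiftModule := inferInstanceAs (NormedAddCommGroup chiIdeal)

instance : NormedSpace ℂ ShiftModule := inferInstanceAs (NormedSpace ℂ chiIdeal)

instance : Module EllInftyᵐᵒᵖ ShiftModule := inferInstanceAs (Module EllInftyᵐᵒᵖ chiIdeal)

/-- The inclusion `E ⊆ ℓ^∞(ℕ)`. -/
def ShiftModule.val (x : ShiftModule) : EllInfty := Subtype.val x

theorem ShiftModule.val_injective : Function.Injective ShiftModule.val := Subtype.val_injective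

instance : CompleteSpace ShiftModule := by
  have h : IsClosed (chiIdeal : Set EllInfty) := by
    have : (chiIdeal : Set EllInfty) = {f | f 0 = 0} := Set.ext fun f => mem_chiIdeal
    rw [this]
    have hc : LipschitzWith 1 (fun f : EllInfty => f 0) := LipschitzWith.of_dist_le_mul
      fun f g => by
        rw [NNReal.coe_one, one_mul, dist_eq_norm, dist_eq_norm]
        exact lp.norm_apply_le_norm ENNReal.top_ne_zero (f - g) 0
    exact isClosed_eq hc.continuous continuous_const
  exact h.completeSpace_coe

/-- The inner product `⟨x | y⟩ = x⋆ y` on `χ ℓ^∞(ℕ)`. -/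
instance : CStarModule EllInftyᵐᵒᵖ ShiftModule where
  inner x y := op (star x.val * y.val)
  inner_add_right {x y z} := congrArg op (mul_add (star x.val) y.val z.val)
  inner_self_nonneg {x} := unop_le_unop.mp (star_mul_self_nonneg x.val)
  inner_self {x} := by
    refine (op_eq_zero_iff _).trans ((CStarRing.star_mul_self_eq_zero_iff x.val).trans ?_)
    exact ⟨fun h => ShiftModule.val_injective h, fun h => congrArg ShiftModule.val h⟩
  inner_op_smul_right {a x y} :=
    congrArg op (mul_assoc (star x.val) y.val (unop a)).symm
  inner_smul_right_complex {c x y} := congrArg op (mul_smul_comm c (star x.val) y.val)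
  star_inner x y := congrArg op ((star_mul (star x.val) y.val).trans
    (congrArg (star y.val * ·) (star_star x.val)))
  norm_eq_sqrt_norm_inner_self x := by
    have : ‖star x.val * x.val‖ = ‖x‖ * ‖x‖ := CStarRing.norm_star_mul_self
    rw [norm_op, this, Real.sqrt_mul_self (norm_nonneg x)]

/-- The unilateral shift on `ℓ^∞(ℕ)`: value `0` at `0` and `f (n - 1)` at `n ≥ 1`. -/
def shift (f : EllInfty) : EllInfty :=
  ⟨fun n => if n = 0 then 0 else f (n - 1), memℓp_infty ⟨‖f‖, by
    rintro _ ⟨n, rfl⟩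
    dsimp only
    split_ifs
    · simp
    · exact lp.norm_apply_le_norm ENNReal.top_ne_zero f _⟩⟩

theorem shift_apply (f : EllInfty) (n : ℕ) : shift f n = if n = 0 then 0 else f (n - 1) := rfl

/-- Multiplication by `shift a` on `χ ℓ^∞(ℕ)`. -/
def shiftMul (a : EllInfty) : ShiftModule →L[ℂ] ShiftModule :=
  LinearMap.mkContinuous
    { toFun := fun x => ⟨shift a * x.val, mem_chiIdeal.2 (by
        change shift a 0 * x.val 0 = 0
        simp [shift_apply])⟩
      map_add' := fun x y => ShiftModule.val_injective (mul_add (shift a) x.val y.val)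
      map_smul' := fun c x => ShiftModule.val_injective (mul_smul_comm c (shift a) x.val) }
    ‖shift a‖ fun x => norm_mul_le (shift a) x.val

theorem shiftMul_val_apply (a : EllInfty) (x : ShiftModule) (n : ℕ) :
    (shiftMul a x).val n = shift a n * x.val n := rfl

theorem ShiftModule.ext {x y : ShiftModule} (h : ∀ n, x.val n = y.val n) : x = y :=
  ShiftModule.val_injective (lp.ext (funext h))

theorem ShiftModule.val_zero_index (x : ShiftModule) : x.val 0 = 0 := mem_chiIdeal.1 x.2

/-- The shift correspondence: `E = χ ℓ^∞(ℕ)` over `ℓ^∞(ℕ)`, where `φ(a)` is multiplication by the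
shift of `a`. -/
def shiftCorrespondence : Correspondence EllInfty ShiftModule where
  leftAct := AlgHom.ofLinearMap
    { toFun := shiftMul
      map_add' := fun a b => ContinuousLinearMap.ext fun x => ShiftModule.ext fun n => by
        change shift (a + b) n * x.val n = shift a n * x.val n + shift b n * x.val n
        rw [← add_mul]
        simp only [shift_apply]
        split_ifs <;> simp
      map_smul' := fun c a => ContinuousLinearMap.ext fun x => ShiftModule.ext fun n => by
        change shift (c • a) n * x.val n = c * (shift a n * x.val n)
        rw [← mul_assoc]
        simp only [shift_apply]
        split_ifs <;> simp }
    (ContinuousLinearMap.ext fun x => ShiftModule.ext fun n => by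
        change shift 1 n * x.val n = x.val n
        simp only [shift_apply]
        split_ifs with h
        · simp [h, x.val_zero_index]
        · simp)
    (fun a b => ContinuousLinearMap.ext fun x => ShiftModule.ext fun n => by
        change shift (a * b) n * x.val n = shift a n * (shift b n * x.val n)
        rw [← mul_assoc]
        simp only [shift_apply]
        split_ifs <;> simp)
  rightInner_leftAct a x y := lp.ext (funext fun n => by
    change star (shift a n * x.val n) * y.val n = star (x.val n) * (shift (star a) n * y.val n)
    simp only [shift_apply]
    split_ifs
    · simp
    · simp
      ring)

end Shift

end CStarCorr

end

namespace CStarCorr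

/-! ### Operators on `ℓ²(ℕ)` -/

/-! Everything non-formal comes from one covariant representation on `ℓ²(ℕ)`: `A` acts by diagonal
operators and `x ∈ E` by `S x`, where `S` is the backward shift. Covariance rests on three facts: `S
S⋆ = 1`, `S⋆ S` is the projection onto the complement of the first basis vector `e₀` (on which
elements of `χA` live), and `S σ(a) S⋆ = a`. Creation operators thus lower the degree in `ℓ²(ℕ)`,
and the gauge automorphism is implemented as `T ↦ U⋆ T U` with `U = diag(zⁿ)` (`regularRep_gauge`).

Since `U` fixes `e₀` and nothing lies below degree zero, `B₁` annihilates `e₀`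
(`regularRep_vacuum_of_mem`). Hence so does the closure of `B₁⋆ B₁`, whereas the unit fixes `e₀`.

The same asymmetry obstructs freeness. The vacuum expectation of `a γ_z(b)` is an absolutely
convergent series in powers `z̄ⁿ`, `n ≥ 0` (`exists_summable_vacuumState_mul_gauge`), so its first
Fourier coefficient is zero. This coefficient is norm continuous on `C(𝕋, B)` and equals `1` on `z ↦
z·1`, so the span is not dense. -/

/-- The Hilbert space `ℓ²(ℕ)`. -/
abbrev EllTwo : Type := lp (fun _ : ℕ => ℂ) 2

theorem EllTwo.clm_ext {S T : EllTwo →L[ℂ] EllTwo} (h : ∀ v n, S v n = T v n) : S = T :=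
  ContinuousLinearMap.ext fun v => lp.ext (funext (h v))

theorem EllTwo.inner_single_one (n : ℕ) (v : EllTwo) :
    inner ℂ (lp.single 2 n (1 : ℂ) : EllTwo) v = v n := by
  rw [lp.inner_single_left]
  simp

/-- The first basis vector of `ℓ²(ℕ)`. -/
noncomputable def vacuum : EllTwo := lp.single 2 0 1

theorem vacuum_apply (n : ℕ) : vacuum n = if n = 0 then 1 else 0 := by
  rw [vacuum, lp.single_apply, Pi.single_apply]

/-- The diagonal operator on `ℓ²(ℕ)` with entries `a`. -/
noncomputable def diagonalCLM (a : EllInfty) : EllTwo →L[ℂ] EllTwo :=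
  lp.mapCLM 2 (fun n => a n • ContinuousLinearMap.id ℂ ℂ) (norm_nonneg a) fun n => by
    rw [norm_smul, ContinuousLinearMap.norm_id, mul_one]
    exact lp.norm_apply_le_norm ENNReal.top_ne_zero a n

theorem diagonalCLM_apply (a : EllInfty) (v : EllTwo) (n : ℕ) :
    diagonalCLM a v n = a n * v n := rfl

theorem star_diagonalCLM (a : EllInfty) : star (diagonalCLM a) = diagonalCLM (star a) := by
  symm
  rw [ContinuousLinearMap.star_eq_adjoint, ContinuousLinearMap.eq_adjoint_iff]
  intro v w
  rw [lp.inner_eq_tsum, lp.inner_eq_tsum]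
  refine tsum_congr fun n => ?_
  change w n * star (star (a n) * v n) = (a n * w n) * star (v n)
  simp
  ring

/-- The representation of `ℓ^∞(ℕ)` on `ℓ²(ℕ)` by diagonal operators. -/
noncomputable def diagonalRep : EllInfty →⋆ₐ[ℂ] (EllTwo →L[ℂ] EllTwo) where
  toFun := diagonalCLM
  map_one' := EllTwo.clm_ext fun v n => one_mul (v n)
  map_mul' a b := EllTwo.clm_ext fun v n => mul_assoc (a n) (b n) (v n)
  map_zero' := EllTwo.clm_ext fun v n => zero_mul (v n)
  map_add' a b := EllTwo.clm_ext fun v n => add_mul (a n) (b n) (v n)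
  commutes' _ := EllTwo.clm_ext fun v n => by
    rw [diagonalCLM_apply, Algebra.algebraMap_eq_smul_one, Algebra.algebraMap_eq_smul_one]
    change _ * (1 : ℂ) * v n = _ * v n
    simp
  map_star' a := (star_diagonalCLM a).symm

theorem diagonalRep_apply (a : EllInfty) (v : EllTwo) (n : ℕ) :
    diagonalRep a v n = a n * v n := rfl

/-- The backward shift on `ℓ²(ℕ)`. -/
noncomputable def backwardShift : EllTwo →L[ℂ] EllTwo :=
  LinearMap.mkContinuous
    { toFun := fun v => ⟨fun n => v (n + 1), by
        have h := (lp.memℓp v).summable (by simp)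
        exact memℓp_gen (h.comp_injective (add_left_injective 1))⟩
      map_add' := fun _ _ => rfl
      map_smul' := fun _ _ => rfl }
    1 fun v => by
      have h := (lp.memℓp v).summable (by simp)
      rw [one_mul]
      refine lp.norm_le_of_tsum_le (by simp) (norm_nonneg v) ?_
      rw [lp.norm_rpow_eq_tsum (by simp) v]
      exact tsum_comp_le_tsum_of_inj h (fun _ => by positivity) (add_left_injective 1)

theorem backwardShift_apply (v : EllTwo) (n : ℕ) : backwardShift v n = v (n + 1) := rfl

/-- Since `S e₀ = 0`, the range of `S⋆` is orthogonal to `e₀`; together with the next lemma this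
identifies `S⋆` as the forward shift. -/
theorem star_backwardShift_apply_zero (v : EllTwo) : star backwardShift v 0 = 0 := by
  rw [← EllTwo.inner_single_one, ContinuousLinearMap.star_eq_adjoint,
    ContinuousLinearMap.adjoint_inner_right]
  have : backwardShift (lp.single 2 0 (1 : ℂ)) = 0 := lp.ext (funext fun n => by
    rw [backwardShift_apply, lp.single_apply_ne _ _ _ n.succ_ne_zero]
    rfl)
  rw [this, inner_zero_left]

theorem star_backwardShift_apply_succ (v : EllTwo) (n : ℕ) :
    star backwardShift v (n + 1) = v n := by
  rw [← EllTwo.inner_single_one, ContinuousLinearMap.star_eq_adjoint,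
    ContinuousLinearMap.adjoint_inner_right]
  have : backwardShift (lp.single 2 (n + 1) (1 : ℂ)) = lp.single 2 n 1 :=
    lp.ext (funext fun m => by
      rw [backwardShift_apply, lp.single_apply, lp.single_apply, Pi.single_apply, Pi.single_apply]
      simp)
  rw [this, EllTwo.inner_single_one]

/-! ### The representation of the shift correspondence on `ℓ²(ℕ)` -/

/-- The element `χ` of the module `χ ℓ^∞(ℕ)`. -/
noncomputable def ShiftModule.generator : ShiftModule :=
  ⟨chi, mem_chiIdeal.2 (by simp [chi_apply])⟩

/-- The inclusion `χ ℓ^∞(ℕ) ⊆ ℓ^∞(ℕ)` as a continuous linear map. -/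
noncomputable def ShiftModule.valCLM : ShiftModule →L[ℂ] EllInfty :=
  LinearMap.mkContinuous
    { toFun := ShiftModule.val
      map_add' := fun _ _ => rfl
      map_smul' := fun _ _ => rfl } 1 fun x => (one_mul ‖x‖).ge

/-- The operator `x ↦ S x`, with `S` the backward shift and `x` acting diagonally. -/
noncomputable def shiftModuleRep : ShiftModule →ₗ[ℂ] (EllTwo →L[ℂ] EllTwo) :=
  LinearMap.mulLeft ℂ backwardShift ∘ₗ diagonalRep.toAlgHom.toLinearMap ∘ₗ
    (ShiftModule.valCLM : ShiftModule →ₗ[ℂ] EllInfty)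

theorem shiftModuleRep_eq (x : ShiftModule) :
    shiftModuleRep x = backwardShift * diagonalRep x.val := rfl

theorem shiftModuleRep_apply (x : ShiftModule) (v : EllTwo) (n : ℕ) :
    shiftModuleRep x v n = x.val (n + 1) * v (n + 1) := rfl

/-- The product is `x⋆ S⋆ S y`, and the projection `S⋆ S` only removes coordinate `0`, where `y ∈
χA` already vanishes. -/
theorem star_shiftModuleRep_mul (x y : ShiftModule) :
    star (shiftModuleRep x) * shiftModuleRep y = diagonalRep (rightInner EllInfty x y) := by
  refine EllTwo.clm_ext fun v n => ?_
  rw [shiftModuleRep_eq, star_mul, ← map_star]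
  change star (x.val n) * star backwardShift (shiftModuleRep y v) n = star (x.val n) * y.val n * v n
  rcases n with _ | n
  · rw [star_backwardShift_apply_zero, y.val_zero_index]
    simp
  · rw [star_backwardShift_apply_succ, shiftModuleRep_apply, mul_assoc]

/-- The map `T ↦ S (T χ) S⋆` inducing the representation of the compact operators. -/
noncomputable def shiftCompactRep :
    (ShiftModule →L[ℂ] ShiftModule) →L[ℂ] (EllTwo →L[ℂ] EllTwo) :=
  ContinuousLinearMap.mul ℂ _ backwardShift ∘L
    (ContinuousLinearMap.mul ℂ (EllTwo →L[ℂ] EllTwo)).flip (star backwardShift) ∘L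
    (⟨diagonalRep.toAlgHom.toLinearMap, continuous_starAlgHom diagonalRep⟩ :
      EllInfty →L[ℂ] (EllTwo →L[ℂ] EllTwo)) ∘L
    ShiftModule.valCLM ∘L ContinuousLinearMap.apply ℂ ShiftModule ShiftModule.generator

theorem shiftCompactRep_apply (T : ShiftModule →L[ℂ] ShiftModule) (v : EllTwo) (n : ℕ) :
    shiftCompactRep T v n = (T ShiftModule.generator).val (n + 1) * v n := by
  change (T ShiftModule.generator).val (n + 1) * star backwardShift v (n + 1) = _
  rw [star_backwardShift_apply_succ]

/-- Here `|x⟩⟨y|` sends `χ` to `x y⋆ χ`, and `χ` is `1` at every index `n + 1` that survives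
compression by `S`. -/
theorem shiftCompactRep_rankOne (x y : ShiftModule) :
    shiftCompactRep (rankOne EllInfty x y) = shiftModuleRep x * star (shiftModuleRep y) := by
  refine EllTwo.clm_ext fun v n => ?_
  rw [shiftCompactRep_apply, shiftModuleRep_eq y, star_mul, ← map_star]
  change x.val (n + 1) * (star (y.val (n + 1)) * chi (n + 1)) * v n =
    x.val (n + 1) * (star (y.val (n + 1)) * star backwardShift v (n + 1))
  rw [star_backwardShift_apply_succ, chi_apply]
  simp [mul_assoc]

/-- Compression by the backward shift undoes `σ`: `S σ(a) χ S⋆ = a`. This is the covariance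
condition. -/
theorem shiftCompactRep_leftAct (a : EllInfty) :
    shiftCompactRep (shiftCorrespondence.leftAct a) = diagonalRep a := by
  refine EllTwo.clm_ext fun v n => ?_
  rw [shiftCompactRep_apply]
  change shift a (n + 1) * chi (n + 1) * v n = a n * v n
  simp [shift_apply, chi_apply]

instance : Nontrivial EllTwo := ⟨vacuum, 0, fun h => by
  have := congrArg (fun v : EllTwo => v 0) h
  simp [vacuum_apply] at this⟩

/-- The covariant representation of the shift correspondence on `ℓ²(ℕ)`. -/
noncomputable def shiftRep : CovariantRep shiftCorrespondence where
  D := EllTwo →L[ℂ] EllTwo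
  π := diagonalRep
  t := shiftModuleRep
  star_t_mul_t := star_shiftModuleRep_mul
  π_mul_t a x := EllTwo.clm_ext fun v n => by
    change a n * (x.val (n + 1) * v (n + 1)) = shift a (n + 1) * x.val (n + 1) * v (n + 1)
    simp [shift_apply, mul_assoc]
  covariant := ⟨shiftCompactRep ∘L (compactOperators EllInfty ShiftModule).subtypeL,
    shiftCompactRep_rankOne, fun a _ => shiftCompactRep_leftAct a⟩

/-- The representation of the Cuntz–Pimsner algebra of the shift correspondence on `ℓ²(ℕ)`. -/
noncomputable def regularRep :
    CuntzPimsner shiftCorrespondence →⋆ₐ[ℂ] (EllTwo →L[ℂ] EllTwo) :=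
  CuntzPimsner.lift shiftRep

theorem regularRep_coeff (a : EllInfty) :
    regularRep (coeff shiftCorrespondence a) = diagonalRep a := rfl

theorem regularRep_creation (x : ShiftModule) :
    regularRep (creation shiftCorrespondence x) = shiftModuleRep x := rfl

/-! ### The gauge action on `ℓ²(ℕ)` -/

/-- The bounded sequence `n ↦ z ^ n`, for `z` in the unit circle. -/
noncomputable def circlePowers (z : Circle) : EllInfty :=
  ⟨fun n => (z : ℂ) ^ n, memℓp_infty ⟨1, by
    rintro _ ⟨n, rfl⟩
    change ‖(z : ℂ) ^ n‖ ≤ 1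
    rw [norm_pow, Circle.norm_coe, one_pow]⟩⟩

theorem circlePowers_apply (z : Circle) (n : ℕ) : circlePowers z n = (z : ℂ) ^ n := rfl

theorem star_circlePowers_apply (z : Circle) (n : ℕ) :
    star (circlePowers z) n = star (z : ℂ) ^ n := star_pow (z : ℂ) n

theorem circlePowers_mem_unitary (z : Circle) : circlePowers z ∈ unitary EllInfty := by
  have h : star (circlePowers z) * circlePowers z = 1 := lp.ext (funext fun n => by
    change star (circlePowers z) n * circlePowers z n = 1
    rw [star_circlePowers_apply, circlePowers_apply, ← mul_pow, circle_star_mul_self, one_pow])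
  exact Unitary.mem_iff.2 ⟨h, mul_comm (circlePowers z) _ ▸ h⟩

/-- The unitary on `ℓ²(ℕ)` with diagonal entries `z ^ n`. -/
noncomputable def gaugeUnitary (z : Circle) : unitary (EllTwo →L[ℂ] EllTwo) :=
  ⟨diagonalRep (circlePowers z), Unitary.map_mem diagonalRep (circlePowers_mem_unitary z)⟩

theorem gaugeUnitary_apply (z : Circle) (v : EllTwo) (n : ℕ) :
    (gaugeUnitary z : EllTwo →L[ℂ] EllTwo) v n = (z : ℂ) ^ n * v n := rfl

theorem star_gaugeUnitary_apply (z : Circle) (v : EllTwo) (n : ℕ) :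
    star (gaugeUnitary z : EllTwo →L[ℂ] EllTwo) v n = star (z : ℂ) ^ n * v n := by
  change star (diagonalRep (circlePowers z)) v n = _
  rw [← map_star, diagonalRep_apply, star_circlePowers_apply]

/-- Both sides are `*`-homomorphisms in `b`, so it suffices to compare generators. Diagonal
operators commute with the unitary; `t(x)` carries degree `n + 1` to degree `n`, so conjugation
yields the factor `z̄ⁿ zⁿ⁺¹ = z`. -/
theorem regularRep_gauge (z : Circle) (b : CuntzPimsner shiftCorrespondence) :
    regularRep (gaugeAction shiftCorrespondence z b) =
      star (gaugeUnitary z : EllTwo →L[ℂ] EllTwo) * regularRep b * gaugeUnitary z := by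
  let c : (EllTwo →L[ℂ] EllTwo) →⋆ₐ[ℂ] (EllTwo →L[ℂ] EllTwo) :=
    (Unitary.conjStarAlgAut ℂ _ (star (gaugeUnitary z))).toStarAlgHom
  have hc : ∀ T, c T = star (gaugeUnitary z : EllTwo →L[ℂ] EllTwo) * T * gaugeUnitary z :=
    fun T => by
      change Unitary.conjStarAlgAut ℂ _ (star (gaugeUnitary z)) T = _
      simp
  have h : regularRep.comp (gaugeAction shiftCorrespondence z) = c.comp regularRep := by
    refine CuntzPimsner.hom_ext (fun a => ?_) fun x => ?_
    · change regularRep (coeff shiftCorrespondence a) = c (regularRep (coeff shiftCorrespondence a))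
      rw [hc, regularRep_coeff]
      refine EllTwo.clm_ext fun v n => ?_
      change _ = star (gaugeUnitary z : EllTwo →L[ℂ] EllTwo)
        (diagonalRep a ((gaugeUnitary z : EllTwo →L[ℂ] EllTwo) v)) n
      rw [star_gaugeUnitary_apply, diagonalRep_apply, diagonalRep_apply, gaugeUnitary_apply,
        mul_left_comm (a n), ← mul_assoc, ← mul_pow, circle_star_mul_self, one_pow, one_mul]
    · change regularRep (gauge shiftCorrespondence z (creation shiftCorrespondence x)) =
        c (regularRep (creation shiftCorrespondence x))
      rw [hc, gauge_creation, map_smul, regularRep_creation]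
      refine EllTwo.clm_ext fun v n => ?_
      change (z : ℂ) * shiftModuleRep x v n = star (gaugeUnitary z : EllTwo →L[ℂ] EllTwo)
        (shiftModuleRep x ((gaugeUnitary z : EllTwo →L[ℂ] EllTwo) v)) n
      rw [star_gaugeUnitary_apply, shiftModuleRep_apply, shiftModuleRep_apply, gaugeUnitary_apply,
        mul_left_comm (x.val (n + 1)), ← mul_assoc (star (z : ℂ) ^ n)]
      have hz : star (z : ℂ) ^ n * (z : ℂ) ^ (n + 1) = z := by
        rw [pow_succ, ← mul_assoc, ← mul_pow, circle_star_mul_self, one_pow, one_mul]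
      rw [hz]
  rw [← hc]
  exact DFunLike.congr_fun h b

theorem gaugeUnitary_vacuum (z : Circle) :
    (gaugeUnitary z : EllTwo →L[ℂ] EllTwo) vacuum = vacuum := by
  refine lp.ext (funext fun n => ?_)
  rw [gaugeUnitary_apply, vacuum_apply]
  split_ifs with h <;> simp [h]

theorem regularRep_gauge_vacuum (z : Circle) (b : CuntzPimsner shiftCorrespondence) (n : ℕ) :
    regularRep (gaugeAction shiftCorrespondence z b) vacuum n =
      star (z : ℂ) ^ n * regularRep b vacuum n := by
  rw [regularRep_gauge]
  change star (gaugeUnitary z : EllTwo →L[ℂ] EllTwo)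
    (regularRep b ((gaugeUnitary z : EllTwo →L[ℂ] EllTwo) vacuum)) n = _
  rw [gaugeUnitary_vacuum, star_gaugeUnitary_apply]

/-- Elements of positive degree annihilate the first basis vector. -/
theorem regularRep_vacuum_of_mem {b : CuntzPimsner shiftCorrespondence}
    (hb : b ∈ spectralSubspace (gaugeAction shiftCorrespondence) 1) :
    regularRep b vacuum = 0 := by
  refine lp.ext (funext fun n => ?_)
  -- Computing the `n`-th coordinate `w` of `γ_z(b) e₀` in two ways gives `z w = z̄ⁿ w`.
  have hz (z : Circle) : (z : ℂ) ^ (n + 1) * regularRep b vacuum n = regularRep b vacuum n := by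
    have h := regularRep_gauge_vacuum z b n
    rw [hb z, zpow_one, map_smul] at h
    change (z : ℂ) * regularRep b vacuum n = _ at h
    rw [pow_succ, mul_assoc, h, ← mul_assoc, ← mul_pow, mul_comm (z : ℂ), circle_star_mul_self,
      one_pow, one_mul]
  -- The exponent `n + 1` is never zero, so a root of `-1` exists and forces `-w = w`.
  obtain ⟨z, hz1⟩ : ∃ z : Circle, (z : ℂ) ^ (n + 1) = -1 := by
    refine ⟨Circle.exp (Real.pi / (n + 1)), ?_⟩
    rw [Circle.coe_exp, ← Complex.exp_nat_mul, ← Complex.exp_pi_mul_I]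
    congr 1
    push_cast
    have : (n + 1 : ℂ) ≠ 0 := by exact_mod_cast n.succ_ne_zero
    field_simp
  have h := hz z
  rw [hz1, neg_one_mul, neg_eq_self] at h
  exact h

/-! ### Spectral subspaces -/

section Spectral

variable {B : Type*} [CStarAlgebra B] (γ : Circle →* (B →⋆ₐ[ℂ] B))

theorem star_mem_spectralSubspace {n : ℤ} {b : B} (hb : b ∈ spectralSubspace γ n) :
    star b ∈ spectralSubspace γ (-n) := fun z => by
  rw [map_star, hb z, star_smul, star_zpow₀, zpow_neg, ← inv_zpow]
  congr 2
  exact eq_inv_of_mul_eq_one_left (circle_star_mul_self z)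

/-- The involution exchanges degrees `k` and `-k`, so the two spanning sets already coincide; this
holds for any circle action. -/
theorem starMul_spectralSubspace_eq_mulStar_neg (n m : ℤ) :
    starMul (spectralSubspace γ n) (spectralSubspace γ m) =
      mulStar (spectralSubspace γ (-n)) (spectralSubspace γ (-m)) := by
  refine congrArg (Submodule.span ℂ) (Set.ext fun b => ⟨?_, ?_⟩)
  · rintro ⟨v, hv, w, hw, rfl⟩
    exact ⟨star v, star_mem_spectralSubspace γ hv, star w, star_mem_spectralSubspace γ hw, by
      rw [star_star]⟩
  · rintro ⟨v, hv, w, hw, rfl⟩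
    exact ⟨star v, neg_neg n ▸ star_mem_spectralSubspace γ hv, star w,
      neg_neg m ▸ star_mem_spectralSubspace γ hw, by rw [star_star]⟩

end Spectral

/-- Annihilating `e₀` is a closed linear condition on `b`, and `v⋆ w` satisfies it as soon as `w`
does; the unit does not. -/
theorem one_notMem_closure_starMul_spectralSubspace :
    (1 : CuntzPimsner shiftCorrespondence) ∉
      closure (starMul (spectralSubspace (gaugeAction shiftCorrespondence) 1)
        (spectralSubspace (gaugeAction shiftCorrespondence) 1) :
        Set (CuntzPimsner shiftCorrespondence)) := by
  intro h
  have hclosed : IsClosed {b : CuntzPimsner shiftCorrespondence | regularRep b vacuum = 0} :=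
    isClosed_eq ((continuous_starAlgHom regularRep).clm_apply continuous_const) continuous_const
  have hsub : (starMul (spectralSubspace (gaugeAction shiftCorrespondence) 1)
      (spectralSubspace (gaugeAction shiftCorrespondence) 1) :
      Set (CuntzPimsner shiftCorrespondence)) ⊆ {b | regularRep b vacuum = 0} := by
    intro b hb
    refine Submodule.span_induction ?_ ?_ ?_ ?_ hb
    · rintro _ ⟨v, -, w, hw, rfl⟩
      change regularRep (star v * w) vacuum = 0
      rw [map_mul, mul_apply_eq_comp, regularRep_vacuum_of_mem hw, map_zero]
    · change regularRep 0 vacuum = 0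
      rw [map_zero, zero_apply]
    · intro x y _ _ hx hy
      change regularRep (x + y) vacuum = 0
      rw [map_add, add_apply, hx, hy, add_zero]
    · intro c x _ hx
      change regularRep (c • x) vacuum = 0
      rw [map_smul, smul_apply, hx, smul_zero]
  have h1 : regularRep 1 vacuum = 0 := closure_minimal hsub hclosed h
  rw [map_one, one_apply_eq_self] at h1
  have := congrArg (fun v : EllTwo => v 0) h1
  simp [vacuum_apply] at this

/-! ### Fourier coefficients and freeness -/

/-- An absolutely convergent Fourier series without positive frequencies has vanishing first
Fourier coefficient. -/
theorem fourierCoeff_one_tsum_eq_zero {c : ℕ → ℂ} (hc : Summable fun n => ‖c n‖) :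
    fourierCoeff (fun x : UnitAddCircle => ∑' n : ℕ, c n * fourier (-(n : ℤ)) x) 1 = 0 := by
  have hF (n : ℕ) (x : UnitAddCircle) :
      ‖fourier (-1) x * (c n * fourier (-(n : ℤ)) x)‖ = ‖c n‖ := by
    rw [norm_mul, norm_mul, fourier_apply, fourier_apply, Circle.norm_coe, Circle.norm_coe,
      one_mul, mul_one]
  -- Integration term by term is allowed because the `n`-th summand has constant modulus `‖c n‖` and
  -- Haar measure has mass one.
  have key := MeasureTheory.hasSum_integral_of_summable_integral_norm
    (μ := AddCircle.haarAddCircle (T := 1))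
    (F := fun (n : ℕ) (x : UnitAddCircle) => fourier (-1) x * (c n * fourier (-(n : ℤ)) x))
    (fun n => Continuous.integrable_of_hasCompactSupport (by fun_prop)
      (HasCompactSupport.of_compactSpace _)) (by simp_rw [hF]; simpa using hc)
  have hzero (n : ℕ) : ∫ x : UnitAddCircle,
      fourier (-1) x * (c n * fourier (-(n : ℤ)) x) ∂AddCircle.haarAddCircle = 0 := by
    have h := fourierCoeff.const_mul (fourier (T := 1) (-(n : ℤ))) (c n) 1
    -- The frequency `-n` is never `1`.
    rw [fourierCoeff_fourier, Pi.single_eq_of_ne (by omega), mul_zero] at h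
    exact h
  simp_rw [hzero] at key
  have h := key.unique hasSum_zero
  rw [fourierCoeff, ← h]
  refine MeasureTheory.integral_congr_ae (Filter.Eventually.of_forall fun x => ?_)
  exact (tsum_mul_left).symm

/-- The vacuum expectation of `b` in the representation on `ℓ²(ℕ)`. -/
noncomputable def vacuumState (b : CuntzPimsner shiftCorrespondence) : ℂ :=
  regularRep b vacuum 0

theorem vacuumState_eq_inner (b : CuntzPimsner shiftCorrespondence) :
    vacuumState b = inner ℂ vacuum (regularRep b vacuum) :=
  (EllTwo.inner_single_one 0 _).symm

theorem continuous_vacuumState : Continuous vacuumState := by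
  simp_rw [funext vacuumState_eq_inner]
  exact continuous_const.inner ((continuous_starAlgHom regularRep).clm_apply continuous_const)

theorem vacuumState_one : vacuumState 1 = 1 := by
  rw [vacuumState, map_one, one_apply_eq_self, vacuum_apply, if_pos rfl]

theorem vacuumState_add (a b : CuntzPimsner shiftCorrespondence) :
    vacuumState (a + b) = vacuumState a + vacuumState b := by
  simp only [vacuumState, map_add]
  rfl

theorem vacuumState_smul (c : ℂ) (b : CuntzPimsner shiftCorrespondence) :
    vacuumState (c • b) = c * vacuumState b := by
  simp only [vacuumState, map_smul]
  rfl

theorem norm_vacuum : ‖vacuum‖ = 1 := by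
  rw [vacuum, lp.norm_single (by simp), norm_one]

theorem norm_vacuumState_le (b : CuntzPimsner shiftCorrespondence) : ‖vacuumState b‖ ≤ ‖b‖ := by
  rw [vacuumState_eq_inner]
  refine (norm_inner_le_norm _ _).trans ?_
  rw [norm_vacuum, one_mul]
  refine ((regularRep b).le_opNorm vacuum).trans ?_
  rw [norm_vacuum, mul_one]
  exact NonUnitalStarAlgHom.norm_apply_le regularRep b

theorem EllTwo.summable_norm_inner (v w : EllTwo) : Summable fun n => ‖inner ℂ (v n) (w n)‖ :=
  (lp.summable_inner (𝕜 := ℂ) (G := fun _ : ℕ => ℂ) v w).norm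

theorem EllTwo.inner_eq_tsum (v w : EllTwo) : inner ℂ v w = ∑' n, inner ℂ (v n) (w n) :=
  lp.inner_eq_tsum v w

/-- As `U` fixes `e₀`, the expectation is `⟨a⋆ e₀, U⋆ b e₀⟩`. Expanding in coordinates puts `z̄ⁿ` on
the `n`-th term, and the coefficients are products of two `ℓ²` sequences, hence absolutely summable.
-/
theorem exists_summable_vacuumState_mul_gauge (a b : CuntzPimsner shiftCorrespondence) :
    ∃ c : ℕ → ℂ, (Summable fun n => ‖c n‖) ∧ ∀ z : Circle,
      vacuumState (a * gaugeAction shiftCorrespondence z b) = ∑' n, c n * star (z : ℂ) ^ n := by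
  refine ⟨fun n => inner ℂ (star (regularRep a) vacuum n) (regularRep b vacuum n),
    EllTwo.summable_norm_inner _ _, fun z => ?_⟩
  rw [vacuumState_eq_inner, map_mul, mul_apply_eq_comp,
    ← ContinuousLinearMap.adjoint_inner_left, ← ContinuousLinearMap.star_eq_adjoint,
    EllTwo.inner_eq_tsum]
  refine tsum_congr fun n => ?_
  rw [regularRep_gauge_vacuum, ← smul_eq_mul, inner_smul_right, mul_comm]

theorem fourier_neg_natCast_eq (n : ℕ) (x : UnitAddCircle) :
    fourier (-(n : ℤ)) x = star (AddCircle.toCircle x : ℂ) ^ n := by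
  rw [fourier_neg, fourier_apply, natCast_zsmul, AddCircle.toCircle_nsmul, Circle.coe_pow, map_pow,
    starRingEnd_apply]

theorem integrable_vacuumState_comp (F : C(Circle, CuntzPimsner shiftCorrespondence)) :
    MeasureTheory.Integrable
      (fun x : UnitAddCircle => vacuumState (F (AddCircle.toCircle x)))
      AddCircle.haarAddCircle :=
  (continuous_vacuumState.comp
    (F.continuous.comp AddCircle.continuous_toCircle)).integrable_of_hasCompactSupport
    (HasCompactSupport.of_compactSpace _)

/-- The first Fourier coefficient of the vacuum expectation vanishes on the span of the functions
`z ↦ a γ_z(b)`. -/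
theorem fourierCoeff_vacuumState_eq_zero {F : C(Circle, CuntzPimsner shiftCorrespondence)}
    (hF : F ∈ Submodule.span ℂ {F : C(Circle, CuntzPimsner shiftCorrespondence) |
      ∃ a b, ∀ z, F z = a * gaugeAction shiftCorrespondence z b}) :
    fourierCoeff (fun x : UnitAddCircle => vacuumState (F (AddCircle.toCircle x))) 1 = 0 := by
  induction hF using Submodule.span_induction with
  | mem F hF =>
    obtain ⟨a, b, h⟩ := hF
    obtain ⟨c, hc, hab⟩ := exists_summable_vacuumState_mul_gauge a b
    simp_rw [h, hab, ← fourier_neg_natCast_eq]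
    exact fourierCoeff_one_tsum_eq_zero hc
  | zero =>
    have h : vacuumState 0 = 0 := by simpa using vacuumState_smul 0 0
    simp [fourierCoeff, h]
  | add F G _ _ hF hG =>
    have h := congrFun (fourierCoeff.add (integrable_vacuumState_comp F)
      (integrable_vacuumState_comp G)) 1
    rw [Pi.add_apply, hF, hG, add_zero] at h
    simp_rw [ContinuousMap.add_apply, vacuumState_add]
    exact h
  | smul c F _ hF =>
    simp_rw [ContinuousMap.smul_apply, vacuumState_smul]
    rw [fourierCoeff.const_mul, hF, mul_zero]

/-- The function `z ↦ z·1` stays away from the span: taking the first Fourier coefficient of the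
vacuum expectation is contractive, kills the span and gives `1` here. -/
theorem not_isFreeAction_shiftCorrespondence :
    ¬ IsFreeAction (gaugeAction shiftCorrespondence) := by
  intro h
  let I : C(Circle, CuntzPimsner shiftCorrespondence) :=
    ⟨fun z => (z : ℂ) • 1, by fun_prop⟩
  -- Any radius below `1` would serve.
  obtain ⟨G, hG, hIG⟩ := Metric.dense_iff.1 h I (1 / 2) (by norm_num)
  rw [Metric.mem_ball, dist_eq_norm] at hG
  have hsub := fourierCoeff.add (integrable_vacuumState_comp (G - I))
      (integrable_vacuumState_comp I)
  have hsum : (fun x : UnitAddCircle => vacuumState ((G - I) (AddCircle.toCircle x))) +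
      (fun x : UnitAddCircle => vacuumState (I (AddCircle.toCircle x))) =
      fun x : UnitAddCircle => vacuumState (G (AddCircle.toCircle x)) := by
    funext x
    rw [Pi.add_apply, ← vacuumState_add, ContinuousMap.sub_apply, sub_add_cancel]
  have hI : (fun x : UnitAddCircle => vacuumState (I (AddCircle.toCircle x))) =
      fourier (T := 1) 1 := by
    funext x
    change vacuumState ((AddCircle.toCircle x : ℂ) • 1) = _
    rw [vacuumState_smul, vacuumState_one, mul_one, fourier_one]
  have h1 := congrFun hsub 1
  rw [hsum, Pi.add_apply, fourierCoeff_vacuumState_eq_zero hIG, hI, fourierCoeff_fourier,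
    Pi.single_eq_same] at h1
  have hle : ‖fourierCoeff
      (fun x : UnitAddCircle => vacuumState ((G - I) (AddCircle.toCircle x))) 1‖ ≤ 1 / 2 := by
    refine (MeasureTheory.norm_integral_le_of_norm_le_const (C := 1 / 2)
      (Filter.Eventually.of_forall fun x => ?_)).trans (by simp)
    rw [norm_smul, fourier_apply, Circle.norm_coe, one_mul]
    exact (norm_vacuumState_le _).trans (((G - I).norm_coe_le_norm _).trans hG.le)
  rw [eq_neg_of_add_eq_zero_left h1.symm, norm_neg, norm_one] at hle
  norm_num at hle

/-! ### Finite generation, faithfulness and the main theorem -/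

theorem finite_shiftModule : Module.Finite EllInftyᵐᵒᵖ ShiftModule :=
  inferInstanceAs (Module.Finite EllInftyᵐᵒᵖ (Submodule.span EllInftyᵐᵒᵖ {chi}))

/-- Evaluating `φ(a) χ` at `n + 1` recovers `a n`. -/
theorem shiftCorrespondence_isFaithful : shiftCorrespondence.IsFaithful := by
  intro a b h
  refine lp.ext (funext fun n => ?_)
  have h1 := congrArg (fun T : ShiftModule →L[ℂ] ShiftModule =>
    (T ShiftModule.generator).val (n + 1)) h
  change shift a (n + 1) * chi (n + 1) = shift b (n + 1) * chi (n + 1) at h1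
  simpa [shift_apply, chi_apply] using h1

end CStarCorr

theorem mainTheorem7 :
    Module.Finite CStarCorr.EllInftyᵐᵒᵖ CStarCorr.ShiftModule ∧
    CStarCorr.shiftCorrespondence.IsFaithful ∧
    (CStarCorr.starMul
        (CStarCorr.spectralSubspace (CStarCorr.gaugeAction CStarCorr.shiftCorrespondence) 1)
        (CStarCorr.spectralSubspace (CStarCorr.gaugeAction CStarCorr.shiftCorrespondence) 1) =
      CStarCorr.mulStar
        (CStarCorr.spectralSubspace (CStarCorr.gaugeAction CStarCorr.shiftCorrespondence) (-1))
        (CStarCorr.spectralSubspace (CStarCorr.gaugeAction CStarCorr.shiftCorrespondence) (-1))) ∧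
    (1 : CStarCorr.CuntzPimsner CStarCorr.shiftCorrespondence) ∉
      closure (CStarCorr.starMul
        (CStarCorr.spectralSubspace (CStarCorr.gaugeAction CStarCorr.shiftCorrespondence) 1)
        (CStarCorr.spectralSubspace (CStarCorr.gaugeAction CStarCorr.shiftCorrespondence) 1) :
        Set (CStarCorr.CuntzPimsner CStarCorr.shiftCorrespondence)) ∧
    ¬ CStarCorr.IsFreeAction (CStarCorr.gaugeAction CStarCorr.shiftCorrespondence) := by
  exact ⟨CStarCorr.finite_shiftModule, CStarCorr.shiftCorrespondence_isFaithful,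
    CStarCorr.starMul_spectralSubspace_eq_mulStar_neg _ 1 1,
    CStarCorr.one_notMem_closure_starMul_spectralSubspace,
    CStarCorr.not_isFreeAction_shiftCorrespondence⟩
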